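/- Let $n\ge 2$ and let $X$ be an $n$-element set. An adversary $A$ chooses an (unknown) element $d\in X$, the defective element. Two cooperating players $B$ and $C$ agree on their deterministic questioning strategies in advance and cannot communicate afterwards. In each round $A$ decides which of $B$ and $C$ asks; that player asks a query $Q\subseteq X$, chosen as a function of everything he has observed so far. The asker learns nothing about the answer to his query. If $d\in Q$ (the answer is YES), the other player learns $Q$ and that the answer was YES; if $d\notin Q$, the other player observes nothing, not even that a query was asked. Thus a player observes, in chronological order, his own queries and those queries of the other player that were answered YES. A player can identify $d$ if $d$ is the only element that is compatible, for some choices of $A$ (and any total number of queries), with what he has observed. Let $f_4(n)$ be the minimum number $k$ such that, for suitable strategies of $B$ and $C$, for every $d\in X$ and all decisions of $A$ on who asks, at least one of $B$ and $C$ can identify $d$ after $k$ queries in total. Then such a $k$ exists and $$f_4(n)\le \lceil\log_2 n\rceil+\lceil\log_2\log_2 n\rceil+2 .$$ -/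

import Mathlib

namespace CoopSearch

/-- The two questioners. -/
inductive Player : Type
  | B
  | C
  deriving DecidableEq

/-- What a questioner can observe: that he asks a query `Q` himself, or that he is told that the
other questioner has asked `Q` and that the answer was YES. -/
inductive Event (X : Type) : Type
  | ask (Q : Finset X)
  | yes (Q : Finset X)

/-- The observations of one questioner, in chronological order. -/
abbrev View (X : Type) : Type := List (Event X)

/-- A pair of questioning strategies, agreed upon in advance: the next query of a questioner is a
function of what he himself has observed so far. -/
abbrev Strategies (X : Type) : Type := Player → View X → Finset X

/-- One round with defective element `d`, in which the adversary lets `p` ask: `p` learns nothing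
about the answer, and the other player observes the query exactly if the answer is YES. -/
def step {X : Type} [DecidableEq X] (σ : Strategies X) (d : X) (v : Player → View X)
    (p : Player) : Player → View X := fun q =>
  if q = p then v q ++ [Event.ask (σ p (v p))]
  else if d ∈ σ p (v p) then v q ++ [Event.yes (σ p (v p))]
  else v q

/-- The views of both players after the rounds in which the adversary lets the players in the
list `s` (first entry first) ask. -/
def views {X : Type} [DecidableEq X] (σ : Strategies X) (d : X) (s : List Player) :
    Player → View X :=
  s.foldl (step σ d) (fun _ => [])

/-- After the rounds `s` with defective element `d`, player `p` can identify `d`: no other element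
is compatible with what he has observed. The list `s'` is arbitrary, since `p` knows neither in
which order the players were called nor how many queries were asked. -/
def Identifies {X : Type} [DecidableEq X] (σ : Strategies X) (d : X) (s : List Player)
    (p : Player) : Prop :=
  ∀ (d' : X) (s' : List Player), views σ d' s' p = views σ d s p → d' = d

/-- Whatever the adversary does (that is, for every defective element and all choices of the
askers), at least one questioner can identify the defective element after `k` queries in total.
(What has been identified earlier remains identified.) -/
def Solves {X : Type} [DecidableEq X] (σ : Strategies X) (k : ℕ) : Prop :=
  ∀ (d : X) (s : List Player), s.length = k → ∃ p : Player, Identifies σ d s p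

/-- The minimum number of queries, in the worst case, that suffices for an `n`-element set
(`⊤` if no number of queries suffices). -/
noncomputable def f4 (n : ℕ) : ℕ∞ :=
  ⨅ k ∈ {k : ℕ | ∃ σ : Strategies (Fin n), Solves σ k}, (k : ℕ∞)

end CoopSearch

/-!
Let `L = ⌈log₂ n⌉` and encode the elements by `L` bits. The strategies below need only `L + 1`
queries, which is less than the stated bound.

The `j`-th query of `B` is about "bit `j` is `1`", that of `C` about "bit `L - 1 - j` is `0`", so the
two lists of questions are run through from opposite ends and are complementary to each other. A
questioner never asks the bare set but its intersection with `cand`, the intersection of all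
queries about which he was told YES. So the queries answered YES shrink: as soon as `p` is told
YES about `Q`, all later queries of `p` are subsets of `Q` (`cand_anti`, `strategy_subset`).

* A YES reveals everything (`agree_of_yes`). Suppose that `q` asks `A`, the answer is YES, and the
  defective elements `d` and `d'` are both compatible with what `other q` then knows; so both lie
  in `A`. If an earlier query `Q` of `other q` contains `d`, then `q` was told so, hence
  `d' ∈ A ⊆ Q`, and conversely; so `d` and `d'` agree on all questions of `other q`. If `d` belongs
  to a question of `q`, then `other q` was told so, hence `d'` belongs to it; the converse needs
  that `q` has asked at least as many questions in the run for `d'` as in the run for `d`.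
* The number of questions can be read off from the view (`told_views`): a question `U q i` that was asked and
  answered NO does not contain `d`, whereas `d ∈ Q` for the query `Q` answered YES. Hence the
  index of the question belonging to `Q` is the least one, from the first index not yet settled on,
  with `Q ⊆ U q i`.
* When a questioner knows in this way that all `L` bits have been asked about, he asks `cand`, to
  which the answer is surely YES. If query number `L` is answered NO, then query number `L + 1` is
  answered YES (`IsMirrored.solves`): unless it is such a `cand`, it repeats the bit of the last
  query of the other questioner, with the complementary question, and that last query was
  answered NO.
-/

namespace CoopSearch

/-- The questioner other than `p`. -/
def other : Player → Player
  | .B => .C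
  | .C => .B

@[simp] lemma other_other (p : Player) : other (other p) = p := by cases p <;> rfl

lemma other_ne (p : Player) : other p ≠ p := by cases p <;> simp [other]

lemma eq_or_eq_other (p q : Player) : q = p ∨ q = other p := by
  cases p <;> cases q <;> simp [other]

lemma count_add_count_other (p : Player) (s : List Player) :
    s.count p + s.count (other p) = s.length := by
  induction s with
  | nil => simp
  | cons q s ih => cases p <;> cases q <;> simp_all [other] <;> omega

/-! ### What a questioner extracts from a view -/

section Views

variable {X : Type}

/-- The number of queries that the owner of a view has asked. -/
def asks (v : View X) : ℕ :=
  v.foldl (fun a e => match e with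
    | .ask _ => a + 1
    | .yes _ => a) 0

/-- The number of queries that the other questioner had asked when he last got a YES, as reconstructed
from a view if his questions are `W 0, W 1, …` in this order. A query `Q` answered YES is attributed
to the first question containing it that is not yet accounted for. If there is none, the junk value
is `1`; this does not happen for a query that comes from one of the questions, see `told_views`. -/
noncomputable def told (W : ℕ → Finset X) (v : View X) : ℕ :=
  v.foldl (fun m e => match e with
    | .ask _ => m
    | .yes Q => sInf {i | m ≤ i ∧ Q ⊆ W i} + 1) 0

@[simp] lemma asks_nil : asks ([] : View X) = 0 := rfl

@[simp] lemma asks_ask (v : View X) (Q : Finset X) : asks (v ++ [.ask Q]) = asks v + 1 := by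
  simp [asks]

@[simp] lemma asks_yes (v : View X) (Q : Finset X) : asks (v ++ [.yes Q]) = asks v := by
  simp [asks]

@[simp] lemma told_nil (W : ℕ → Finset X) : told W ([] : View X) = 0 := rfl

@[simp] lemma told_ask (W : ℕ → Finset X) (v : View X) (Q : Finset X) :
    told W (v ++ [.ask Q]) = told W v := by
  simp [told]

@[simp] lemma told_yes (W : ℕ → Finset X) (v : View X) (Q : Finset X) :
    told W (v ++ [.yes Q]) = sInf {i | told W v ≤ i ∧ Q ⊆ W i} + 1 := by
  simp [told]

variable {U : Player → ℕ → Finset X} {L : ℕ}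

/-- In the view `v`, every query of `p` was asked while `p` could not yet be sure that all `L` bits had
been asked about; so under `strategy U L` it came from a question `U p i`. -/
def Regular (U : Player → ℕ → Finset X) (L : ℕ) (p : Player) (v : View X) : Prop :=
  ∀ v₀ Q, v₀ ++ [.ask Q] <+: v → asks v₀ + told (U (other p)) v₀ < L

lemma Regular.mono {p : Player} {v w : View X} (h : Regular U L p w) (hvw : v <+: w) :
    Regular U L p v := fun v₀ Q h₀ => h v₀ Q (h₀.trans hvw)

lemma Regular.concat_ask {p : Player} {v : View X} (h : Regular U L p v)
    (hlt : asks v + told (U (other p)) v < L) (Q : Finset X) :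
    Regular U L p (v ++ [.ask Q]) := by
  intro v₀ Q₀ h₀
  obtain h₀ | h₀ := List.prefix_concat_iff.1 h₀
  · rwa [(List.append_inj' h₀ rfl).1]
  · exact h v₀ Q₀ h₀

lemma Regular.concat_yes {p : Player} {v : View X} (h : Regular U L p v) (Q : Finset X) :
    Regular U L p (v ++ [.yes Q]) := by
  intro v₀ Q₀ h₀
  obtain h₀ | h₀ := List.prefix_concat_iff.1 h₀
  · simpa using (List.append_inj' h₀ rfl).2
  · exact h v₀ Q₀ h₀

variable [DecidableEq X]

/-- The number of questions among `W 0, …, W (a - 1)` up to the last one that contains `d`, and `0` if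
no one does. -/
def lastYes (W : ℕ → Finset X) (d : X) : ℕ → ℕ
  | 0 => 0
  | a + 1 => if d ∈ W a then a + 1 else lastYes W d a

lemma lastYes_le (W : ℕ → Finset X) (d : X) (a : ℕ) : lastYes W d a ≤ a := by
  induction a with
  | zero => simp [lastYes]
  | succ a ih => rw [lastYes]; split <;> omega

lemma lt_lastYes {W : ℕ → Finset X} {d : X} {a i : ℕ} (hi : i < a) (hd : d ∈ W i) :
    i < lastYes W d a := by
  induction a with
  | zero => omega
  | succ a ih =>
    rw [lastYes]
    split
    · omega
    · rename_i h
      have : i ≠ a := fun e => h (e ▸ hd)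
      exact ih (by omega)

variable [Fintype X]

/-- The elements that belong to every query about which the owner of the view was told YES. -/
def cand (v : View X) : Finset X :=
  v.foldl (fun T e => match e with
    | .ask _ => T
    | .yes Q => T ∩ Q) Finset.univ

@[simp] lemma cand_nil : cand ([] : View X) = Finset.univ := rfl

@[simp] lemma cand_ask (v : View X) (Q : Finset X) : cand (v ++ [.ask Q]) = cand v := by
  simp [cand]

@[simp] lemma cand_yes (v : View X) (Q : Finset X) : cand (v ++ [.yes Q]) = cand v ∩ Q := by
  simp [cand]

lemma cand_anti {v w : View X} (h : v <+: w) : cand w ⊆ cand v := by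
  obtain ⟨t, rfl⟩ := h
  induction t using List.reverseRecOn with
  | nil => simp
  | append_singleton t e ih =>
    rw [← List.append_assoc]
    cases e with
    | ask Q => rwa [cand_ask]
    | yes Q => rw [cand_yes]; exact Finset.inter_subset_left.trans ih

end Views

/-! ### The strategies and the runs they produce -/

section Runs

variable {X : Type} [DecidableEq X]

@[simp] lemma views_nil (σ : Strategies X) (d : X) (p : Player) : views σ d [] p = [] := rfl

lemma views_concat_self (σ : Strategies X) (d : X) (s : List Player) (p : Player) :
    views σ d (s ++ [p]) p = views σ d s p ++ [.ask (σ p (views σ d s p))] := by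
  simp [views, step]

lemma views_concat_other (σ : Strategies X) (d : X) (s : List Player) (p : Player) :
    views σ d (s ++ [p]) (other p) =
      if d ∈ σ p (views σ d s p) then views σ d s (other p) ++ [.yes (σ p (views σ d s p))]
      else views σ d s (other p) := by
  rw [views, List.foldl_append]
  exact if_neg (other_ne p)

lemma views_concat_other' (σ : Strategies X) (d : X) (s : List Player) (p : Player) :
    views σ d (s ++ [other p]) p =
      if d ∈ σ (other p) (views σ d s (other p)) then
        views σ d s p ++ [.yes (σ (other p) (views σ d s (other p)))]
      else views σ d s p := by
  simpa using views_concat_other σ d s (other p)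

lemma views_concat_cases (σ : Strategies X) (d : X) (s : List Player) (p q : Player) :
    views σ d (s ++ [q]) p = views σ d s p ∨
      ∃ e, views σ d (s ++ [q]) p = views σ d s p ++ [e] := by
  obtain rfl | rfl := eq_or_eq_other p q
  · exact .inr ⟨_, views_concat_self ..⟩
  · rw [views_concat_other']
    split
    · exact .inr ⟨_, rfl⟩
    · exact .inl rfl

lemma views_prefix (σ : Strategies X) (d : X) (p : Player) {s t : List Player} (h : s <+: t) :
    views σ d s p <+: views σ d t p := by
  obtain ⟨u, rfl⟩ := h
  induction u using List.reverseRecOn with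
  | nil => simp
  | append_singleton u q ih =>
    rw [← List.append_assoc]
    obtain h | ⟨e, h⟩ := views_concat_cases σ d (s ++ u) p q <;> rw [h]
    · exact ih
    · exact ih.trans (List.prefix_append _ _)

lemma exists_views_eq_of_prefix (σ : Strategies X) (d : X) (p : Player) (s : List Player)
    {v : View X} (h : v <+: views σ d s p) : ∃ s₀, views σ d s₀ p = v := by
  induction s using List.reverseRecOn with
  | nil => exact ⟨[], (List.prefix_nil.1 h).symm⟩
  | append_singleton s q ih =>
    obtain h' | ⟨e, h'⟩ := views_concat_cases σ d s p q
    · exact ih (h' ▸ h)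
    · rw [h', List.prefix_concat_iff] at h
      obtain h | h := h
      · exact ⟨s ++ [q], h'.trans (by simp [h])⟩
      · exact ih h

/-- What has been identified remains identified. -/
lemma Identifies.append {σ : Strategies X} {d : X} {s : List Player} {p : Player}
    (h : Identifies σ d s p) (t : List Player) : Identifies σ d (s ++ t) p := by
  intro d' s' hv
  obtain ⟨s₀, h₀⟩ := exists_views_eq_of_prefix σ d' p s'
    (hv ▸ views_prefix σ d p (List.prefix_append s t))
  exact h d' s₀ h₀

/-- A view that ends with a YES was already the same when this YES came in: later queries of `q`
left no trace. -/
lemma exists_of_views_eq_concat_yes {σ : Strategies X} {d : X} {q : Player} {s : List Player}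
    {v : View X} {A : Finset X} (h : views σ d s (other q) = v ++ [.yes A]) :
    ∃ s₀, views σ d s₀ (other q) = v ∧ σ q (views σ d s₀ q) = A ∧ d ∈ A := by
  induction s using List.reverseRecOn with
  | nil => simp at h
  | append_singleton s r ih =>
    obtain rfl | rfl := eq_or_eq_other q r
    · rw [views_concat_other] at h
      split at h
      · rename_i hd
        have h' := List.append_inj' h rfl
        have hA : σ r (views σ d s r) = A := by simpa using h'.2
        exact ⟨s, h'.1, hA, hA ▸ hd⟩
      · exact ih h
    · rw [views_concat_self] at h
      simpa using (List.append_inj' h rfl).2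

@[simp] lemma asks_views (σ : Strategies X) (d : X) (s : List Player) (p : Player) :
    asks (views σ d s p) = s.count p := by
  induction s using List.reverseRecOn with
  | nil => simp
  | append_singleton s q ih =>
    obtain rfl | rfl := eq_or_eq_other p q
    · simp [views_concat_self, ih]
    · rw [views_concat_other']
      split <;> simp [ih, other_ne]

variable [Fintype X]

/-- The questioner `p` asks his next question `U p i`, intersected with the set of elements he
considers possible. Once he knows that both questioners together have asked at least `L` queries, he
asks the whole set of these elements, which contains the defective element. -/
noncomputable def strategy (U : Player → ℕ → Finset X) (L : ℕ) : Strategies X := fun p v =>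
  if asks v + told (U (other p)) v < L then cand v ∩ U p (asks v) else cand v

variable {U : Player → ℕ → Finset X} {L : ℕ}

lemma strategy_of_lt {p : Player} {v : View X} (h : asks v + told (U (other p)) v < L) :
    strategy U L p v = cand v ∩ U p (asks v) := if_pos h

lemma strategy_of_le {p : Player} {v : View X} (h : L ≤ asks v + told (U (other p)) v) :
    strategy U L p v = cand v := if_neg (by omega)

lemma strategy_subset (p : Player) (v : View X) : strategy U L p v ⊆ cand v := by
  unfold strategy
  split
  · exact Finset.inter_subset_left
  · exact subset_rfl

lemma mem_cand_views (σ : Strategies X) (d : X) (s : List Player) (p : Player) :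
    d ∈ cand (views σ d s p) := by
  induction s using List.reverseRecOn with
  | nil => simp
  | append_singleton s q ih =>
    obtain rfl | rfl := eq_or_eq_other p q
    · simpa [views_concat_self] using ih
    · rw [views_concat_other']
      split
      · rename_i h
        rw [cand_yes]
        exact Finset.mem_inter.2 ⟨ih, h⟩
      · exact ih

lemma Regular.concat_other {d : X} {s : List Player} {p : Player}
    (h : Regular U L p (views (strategy U L) d s p)) :
    Regular U L p (views (strategy U L) d (s ++ [other p]) p) := by
  rw [views_concat_other']
  split
  · exact h.concat_yes _
  · exact h

lemma Regular.lt {d : X} {s : List Player} {p : Player}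
    (h : Regular U L p (views (strategy U L) d (s ++ [p]) p)) :
    s.count p + told (U (other p)) (views (strategy U L) d s p) < L := by
  rw [views_concat_self] at h
  simpa using h _ _ List.prefix_rfl

lemma mem_strategy_iff {d : X} {s : List Player} {p : Player}
    (h : s.count p + told (U (other p)) (views (strategy U L) d s p) < L) :
    d ∈ strategy U L p (views (strategy U L) d s p) ↔ d ∈ U p (s.count p) := by
  rw [strategy_of_lt (by simpa using h)]
  simp [mem_cand_views]

/-- As long as `p` asks regular queries, the other questioner counts correctly, up to the last query
answered YES. -/
lemma told_views {d : X} {s : List Player} {p : Player}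
    (h : Regular U L p (views (strategy U L) d s p)) :
    told (U p) (views (strategy U L) d s (other p)) = lastYes (U p) d (s.count p) := by
  induction s using List.reverseRecOn with
  | nil => simp [lastYes]
  | append_singleton s q ih =>
    specialize ih (h.mono (views_prefix _ _ _ (List.prefix_append _ _)))
    obtain rfl | rfl := eq_or_eq_other p q
    · have hlt := h.lt
      rw [views_concat_other]
      simp only [List.count_append, List.count_singleton_self, lastYes, mem_strategy_iff hlt]
      split
      · rename_i hd
        rw [told_yes, ih]
        have hmem := (mem_strategy_iff hlt).2 hd
        congr 1
        refine le_antisymm (Nat.sInf_le ⟨lastYes_le .., ?_⟩)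
          (le_csInf ⟨s.count q, lastYes_le .., ?_⟩ ?_)
        · rw [strategy_of_lt (by simpa using hlt)]; simp
        · rw [strategy_of_lt (by simpa using hlt)]; simp
        · rintro i ⟨hi, hsub⟩
          by_contra! hlt'
          exact absurd (lt_lastYes hlt' (hsub hmem)) (by omega)
      · exact ih
    · rw [views_concat_self, told_ask, ih]
      simp [other_ne]

lemma told_views_le {d : X} {s : List Player} {p : Player}
    (h : Regular U L p (views (strategy U L) d s p)) :
    told (U p) (views (strategy U L) d s (other p)) ≤ s.count p :=
  (told_views h).trans_le (lastYes_le ..)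

/-- During the first `L` rounds, nobody can believe that `L` queries have been asked before. -/
lemma regular_of_length_le (d : X) {s : List Player} (hs : s.length ≤ L) (p : Player) :
    Regular U L p (views (strategy U L) d s p) := by
  induction s using List.reverseRecOn generalizing p with
  | nil => intro v₀ Q h; simp at h
  | append_singleton s q ih =>
    simp only [List.length_append, List.length_singleton] at hs
    specialize ih (by omega)
    obtain rfl | rfl := eq_or_eq_other p q
    · rw [views_concat_self]
      refine (ih q).concat_ask ?_ _
      have h := told_views_le (ih (other q))
      have := count_add_count_other q s
      rw [other_other] at h
      simp only [asks_views]
      omega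
    · exact (ih p).concat_other

/-- A run in which `q` is not regular has a prefix in which he is still regular, but already knows that
`L` queries have been asked. -/
lemma regular_or_exists_prefix (d : X) (s : List Player) (q : Player) :
    Regular U L q (views (strategy U L) d s q) ∨
      ∃ s₀, s₀ <+: s ∧ Regular U L q (views (strategy U L) d s₀ q) ∧
        L ≤ s₀.count q + told (U (other q)) (views (strategy U L) d s₀ q) := by
  induction s using List.reverseRecOn with
  | nil => left; intro v₀ Q h; simp at h
  | append_singleton s r ih =>
    obtain ih | ⟨s₀, h₀, h₁⟩ := ih
    · obtain rfl | rfl := eq_or_eq_other q r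
      · by_cases hlt : s.count r + told (U (other r)) (views (strategy U L) d s r) < L
        · left
          rw [views_concat_self]
          exact ih.concat_ask (by simpa using hlt) _
        · exact .inr ⟨s, List.prefix_append _ _, ih, by omega⟩
      · exact .inl ih.concat_other
    · exact .inr ⟨s₀, h₀.trans (List.prefix_append _ _), h₁⟩

/-- After a question of `p` that contains `d`, the other questioner considers only elements of this
question possible. -/
lemma cand_subset_of_mem {d : X} {s : List Player} {p : Player}
    (h : Regular U L p (views (strategy U L) d s p)) {i : ℕ} (hi : i < s.count p)
    (hd : d ∈ U p i) : cand (views (strategy U L) d s (other p)) ⊆ U p i := by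
  induction s using List.reverseRecOn with
  | nil => simp at hi
  | append_singleton s q ih =>
    specialize ih (h.mono (views_prefix _ _ _ (List.prefix_append _ _)))
    have hanti := cand_anti (views_prefix (strategy U L) d (other p) (List.prefix_append s [q]))
    obtain rfl | rfl := eq_or_eq_other p q
    · simp only [List.count_append, List.count_singleton_self] at hi
      by_cases hi' : i < s.count q
      · exact hanti.trans (ih hi')
      · obtain rfl : i = s.count q := by omega
        have hlt := h.lt
        rw [views_concat_other, if_pos ((mem_strategy_iff hlt).2 hd), cand_yes,
          strategy_of_lt (by simpa using hlt), asks_views]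
        exact Finset.inter_subset_right.trans Finset.inter_subset_right
    · exact hanti.trans (ih (by simpa [other_ne] using hi))

/-! ### Identification at a YES -/

/-- Let the query that `q` asks after the rounds `s` be answered YES. An element `d'` that is compatible
with the resulting view of the other questioner agrees with `d` on all questions asked in `s`. The
length of `s'` is not bounded, so `q` need not be regular in this second run. -/
lemma agree_of_yes {d d' : X} {s s' : List Player} {q : Player} (hs : s.length ≤ L)
    (hv : views (strategy U L) d' s' (other q) = views (strategy U L) d s (other q))
    (hA : strategy U L q (views (strategy U L) d' s' q) =
      strategy U L q (views (strategy U L) d s q))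
    (hd : d ∈ strategy U L q (views (strategy U L) d s q))
    (hd' : d' ∈ strategy U L q (views (strategy U L) d s q)) :
    (∀ i < s.count (other q), (d ∈ U (other q) i ↔ d' ∈ U (other q) i)) ∧
      ∀ i < s.count q, (d ∈ U q i ↔ d' ∈ U q i) := by
  have hcnt : s'.count (other q) = s.count (other q) := by
    simpa using congrArg asks hv
  have hreg := fun p => regular_of_length_le (U := U) d hs p
  have hreg' : Regular U L (other q) (views (strategy U L) d' s' (other q)) := hv ▸ hreg _
  have hlen := count_add_count_other q s
  refine ⟨fun i hi => ⟨fun h => ?_, fun h => ?_⟩, fun i hi => ⟨fun h => ?_, fun h => ?_⟩⟩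
  · have := cand_subset_of_mem (hreg (other q)) hi h
    rw [other_other] at this
    exact this (strategy_subset _ _ hd')
  · have := cand_subset_of_mem hreg' (hcnt ▸ hi) h
    rw [other_other] at this
    exact this (strategy_subset _ _ (hA ▸ hd))
  · have := cand_subset_of_mem (hreg q) hi h
    rw [← hv] at this
    exact this (mem_cand_views ..)
    -- In the second run, too, `q` has asked at least `s.count q` regular questions.
  · have key : ∃ s₀, s₀ <+: s' ∧ Regular U L q (views (strategy U L) d' s₀ q) ∧
        s.count q ≤ s₀.count q := by
      -- When `q` leaves the regular questions, he has asked `L - s.count (other q)` of them.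
      have hle : ∀ s₀, s₀ <+: s' →
          L ≤ s₀.count q + told (U (other q)) (views (strategy U L) d' s₀ q) →
          s.count q ≤ s₀.count q := by
        intro s₀ h₀ hL
        have h₁ := told_views_le (hreg'.mono (views_prefix _ _ _ h₀))
        have h₂ := h₀.sublist.count_le (other q)
        rw [other_other] at h₁
        omega
      obtain hr | ⟨s₀, h₀, hr, hL⟩ := regular_or_exists_prefix (U := U) (L := L) d' s' q
      · refine ⟨s', List.prefix_rfl, hr, ?_⟩
        by_cases hlt : s'.count q + told (U (other q)) (views (strategy U L) d' s' q) < L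
          -- Otherwise `A` is a regular query that in the first run was asked already within `s`
          -- and answered YES, so the two views would yield different counts.
        · by_contra! hc
          have h₁ : d ∈ U q (s'.count q) := by
            rw [← hA, strategy_of_lt (by simpa using hlt), asks_views] at hd
            exact (Finset.mem_inter.1 hd).2
          have h₂ := lt_lastYes hc h₁
          have h₃ := told_views_le hr
          rw [hv, told_views (hreg q)] at h₃
          omega
        · exact hle s' List.prefix_rfl (by omega)
      · exact ⟨s₀, h₀, hr, hle s₀ h₀ hL⟩
    obtain ⟨s₀, h₀, hr, hc⟩ := key
    have := cand_subset_of_mem hr (hi.trans_le hc) h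
    refine this (cand_anti (views_prefix _ _ _ h₀) ?_)
    rw [hv]
    exact mem_cand_views ..

/-- The questions `0, …, L - 1` of one questioner are the complements of those of the other one in
reverse order, and they separate the elements. -/
structure IsMirrored (U : Player → ℕ → Finset X) (L : ℕ) : Prop where
  compl : ∀ p i, i < L → U (other p) (L - 1 - i) = (U p i)ᶜ
  separates : ∀ p x y, (∀ i < L, (x ∈ U p i ↔ y ∈ U p i)) → x = y

lemma IsMirrored.eq_of_agree (hU : IsMirrored U L) {x y : X} {p : Player} {a b : ℕ}
    (hab : L ≤ a + b) (ha : ∀ i < a, (x ∈ U (other p) i ↔ y ∈ U (other p) i))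
    (hb : ∀ i < b, (x ∈ U p i ↔ y ∈ U p i)) : x = y := by
  refine hU.separates p x y fun i hi => ?_
  by_cases h : i < b
  · exact hb i h
  · have := ha (L - 1 - i) (by omega)
    rw [hU.compl p i hi, Finset.mem_compl, Finset.mem_compl] at this
    exact not_iff_not.1 this

/-- A YES in round `L` or `L + 1` identifies the defective element. In round `L`, the question belonging
to this query is needed as well. -/
lemma IsMirrored.identifies (hU : IsMirrored U L) {d : X} {s : List Player} {q : Player}
    (hs : s.length ≤ L) (hs' : L ≤ s.length + 1)
    (hd : d ∈ strategy U L q (views (strategy U L) d s q)) :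
    Identifies (strategy U L) d (s ++ [q]) (other q) := by
  intro d' s' hv
  rw [views_concat_other, if_pos hd] at hv
  obtain ⟨s₀, hv₀, hA, hd'⟩ := exists_of_views_eq_concat_yes hv
  obtain ⟨h₁, h₂⟩ := agree_of_yes hs hv₀ hA hd hd'
  have hlen := count_add_count_other q s
  symm
  obtain hL | hL := hs.lt_or_eq
  · have hlt : s.count q + told (U (other q)) (views (strategy U L) d s q) < L := by
      have := told_views_le (regular_of_length_le (U := U) d hs (other q))
      rw [other_other] at this
      omega
    rw [strategy_of_lt (by simpa using hlt), asks_views, Finset.mem_inter] at hd hd'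
    refine hU.eq_of_agree (a := s.count (other q)) (b := s.count q + 1) (by omega) h₁ ?_
    intro i hi
    obtain hi | rfl := Nat.lt_succ_iff_lt_or_eq.1 hi
    · exact h₂ i hi
    · simp [hd.2, hd'.2]
  · exact hU.eq_of_agree (by omega) h₁ h₂

/-! ### One more query -/

lemma IsMirrored.solves (hU : IsMirrored U L) (hL : 1 ≤ L) : Solves (strategy U L) (L + 1) := by
  intro d s hs
  obtain ⟨s, r, rfl⟩ : ∃ t r, s = t ++ [r] := ⟨_, _, (List.dropLast_append_getLast
    (List.ne_nil_of_length_pos (by omega))).symm⟩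
  obtain ⟨s, q, rfl⟩ : ∃ t q, s = t ++ [q] := ⟨_, _, (List.dropLast_append_getLast
    (List.ne_nil_of_length_pos (by simp at hs; omega))).symm⟩
  simp only [List.length_append, List.length_singleton] at hs
  -- `q` asks in round `L`, and `r` in round `L + 1`.
  by_cases hq : d ∈ strategy U L q (views (strategy U L) d s q)
  · exact ⟨_, (hU.identifies (by omega) (by omega) hq).append [r]⟩
  refine ⟨other r, hU.identifies (by simp; omega) (by simp; omega) ?_⟩
  by_cases hlt : (s ++ [q]).count r +
      told (U (other r)) (views (strategy U L) d (s ++ [q]) r) < L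
  swap
  · rw [strategy_of_le (by rw [asks_views]; omega)]
    exact mem_cand_views ..
  have hlen : (s ++ [q]).length = L := by simp; omega
  have hcnt := count_add_count_other q s
  have hreg := fun p => regular_of_length_le (U := U) d hlen.le p
  rw [mem_strategy_iff (hreg q).lt] at hq
  rw [mem_strategy_iff hlt]
  obtain rfl | rfl := eq_or_eq_other q r
    -- The same questioner asks again: his question is complementary to the last one of the other
    -- questioner, which was answered NO since `r` does not know about it.
  · have ht := told_views (hreg (other r))
    rw [other_other] at ht
    rw [ht] at hlt
    simp only [List.count_append, List.count_singleton_self, List.count_singleton] at hlt ⊢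
    simp only [beq_iff_eq, (other_ne r).symm, if_false, Nat.add_zero] at hlt
    have hnm : d ∉ U (other r) (s.count (other r) - 1) := fun h => by
      have := lt_lastYes (a := s.count (other r)) (by omega) h
      omega
    have hc := hU.compl r (s.count r + 1) (by omega)
    rw [show L - 1 - (s.count r + 1) = s.count (other r) - 1 by omega] at hc
    simpa [hc] using hnm
    -- The questioner changes: his question is complementary to the one of round `L`.
  · have hc := hU.compl q (s.count q) (by omega)
    rw [show L - 1 - s.count q = s.count (other q) by omega] at hc
    simpa [hc, List.count_singleton, (other_ne q).symm] using hq

end Runs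

/-! ### Binary digits -/

/-- The questions about the binary digits: `B` asks for digits `1`, from the lowest digit upwards, and
`C` asks for digits `0`, from digit `L - 1` downwards. -/
def binaryCode (n L : ℕ) : Player → ℕ → Finset (Fin n)
  | .B, i => Finset.univ.filter fun x => (x : ℕ).testBit i
  | .C, i => (Finset.univ.filter fun x => (x : ℕ).testBit (L - 1 - i))ᶜ

lemma isMirrored_binaryCode {n L : ℕ} (h : n ≤ 2 ^ L) : IsMirrored (binaryCode n L) L := by
  have hsep : ∀ x y : Fin n, (∀ i < L, ((x : ℕ).testBit i = (y : ℕ).testBit i)) → x = y := by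
    intro x y hxy
    ext
    refine Nat.eq_of_testBit_eq fun i => ?_
    by_cases hi : i < L
    · exact hxy i hi
    · have hp : 2 ^ L ≤ 2 ^ i := Nat.pow_le_pow_right two_pos (by omega)
      rw [Nat.testBit_lt_two_pow (by omega), Nat.testBit_lt_two_pow (by omega)]
  constructor
  · rintro (_ | _) i hi
    · simp only [binaryCode, other, Nat.sub_sub_self (show i ≤ L - 1 by omega)]
    · simp [binaryCode, other]
  · rintro (_ | _) x y hxy
    · refine hsep x y fun i hi => ?_
      exact Bool.eq_iff_iff.2 (by simpa [binaryCode] using hxy i hi)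
    · refine hsep x y fun i hi => ?_
      have := hxy (L - 1 - i) (by omega)
      simp only [binaryCode, Nat.sub_sub_self (show i ≤ L - 1 by omega), Finset.mem_compl,
        Finset.mem_filter_univ] at this
      exact Bool.eq_iff_iff.2 (not_iff_not.1 this)

lemma f4_le {n L : ℕ} (hL : 1 ≤ L) (h : n ≤ 2 ^ L) : f4 n ≤ ((L + 1 : ℕ) : ℕ∞) :=
  iInf₂_le (L + 1) ⟨_, (isMirrored_binaryCode h).solves hL⟩

end CoopSearch

theorem theorem4 (n : ℕ) (hn : 2 ≤ n) :
    CoopSearch.f4 n ≤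
      ((⌈Real.logb 2 (n : ℝ)⌉₊ + ⌈Real.logb 2 (Real.logb 2 (n : ℝ))⌉₊ + 2 : ℕ) : ℕ∞) := by
  have hn' : (2 : ℝ) ≤ n := by exact_mod_cast hn
  have hL : 1 ≤ ⌈Real.logb 2 (n : ℝ)⌉₊ :=
    Nat.ceil_pos.2 (Real.logb_pos one_lt_two (by linarith))
  have hpow : n ≤ 2 ^ ⌈Real.logb 2 (n : ℝ)⌉₊ := by
    have h := (Real.logb_le_iff_le_rpow one_lt_two (by linarith)).1
      (Nat.le_ceil (Real.logb 2 (n : ℝ)))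
    rw [Real.rpow_natCast] at h
    exact_mod_cast h
  refine (CoopSearch.f4_le hL hpow).trans ?_
  exact_mod_cast (by omega : ⌈Real.logb 2 (n : ℝ)⌉₊ + 1 ≤
    ⌈Real.logb 2 (n : ℝ)⌉₊ + ⌈Real.logb 2 (Real.logb 2 (n : ℝ))⌉₊ + 2)
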